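/- There is a numerical constant $c>0$ such that the following holds for every integer $n\ge 1$. Let $\gamma_n$ be the standard Gaussian measure on $\mathbb{R}^n$, that is, the law of a vector $(X_1,\dots,X_n)$ of independent standard Gaussian random variables, and let $M_n=\max_{1\le i\le n}X_i$ be the largest coordinate. Then $M_n$ is integrable with respect to $\gamma_n$ and $$\gamma_n\big(M_n-\mathbb{E}[M_n]\ge t\big)\le 3e^{-ct\sqrt{\log n}}\qquad\text{for all } t\ge 0,$$ where $\mathbb{E}[M_n]$ is the expectation of $M_n$ under $\gamma_n$. -/

import Mathlib

open MeasureTheory ProbabilityTheory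

namespace GaussianMax

/-- The standard Gaussian measure on `ℝⁿ`: the law of `n` i.i.d. standard Gaussian variables. -/
noncomputable def gamma (n : ℕ) : Measure (Fin n → ℝ) :=
  Measure.pi fun _ : Fin n => gaussianReal 0 1

/-- The largest coordinate of `x ∈ ℝⁿ`, for `n ≥ 1` (a supremum over a finite non-empty set). -/
noncomputable def maxCoord (n : ℕ) (x : Fin n → ℝ) : ℝ := ⨆ i : Fin n, x i

end GaussianMax

namespace GaussianMax

open Set

/-! Write Φ for the Gaussian distribution function and m for the mean of the maximum M. Since Φ is
log-concave, Jensen gives n log Φ(m) ≥ E log Φ(M)^n. Φ^n is the distribution function of M, so the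
right side is at least -1, the mean of the logarithm of a uniform variable. Hence n(1 - Φ(m)) ≤ 1. A
union bound at m + t and the decay of the Gaussian tail from m to m + t then give the bound exp(-(mt
+ t²/2)). The same inequality with a lower bound on the tail gives log n ≤ m² + 2, which trades m
for √(log n). -/

/-- The cumulative distribution function of the standard Gaussian law. -/
noncomputable def stdCDF (x : ℝ) : ℝ := ∫ u in Iic x, gaussianPDFReal 0 1 u

/-- The upper tail of the standard Gaussian law. -/
noncomputable def stdTail (x : ℝ) : ℝ := ∫ u in Ici x, gaussianPDFReal 0 1 u

/-! ### One-dimensional Gaussian estimates -/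

lemma stdPDF_eq (x : ℝ) :
    gaussianPDFReal 0 1 x = (√(2 * Real.pi))⁻¹ * Real.exp (-(x ^ 2 / 2)) := by
  simp [gaussianPDFReal, neg_div]

lemma continuous_stdPDF : Continuous (gaussianPDFReal 0 1) := by
  have : gaussianPDFReal 0 1 = fun x => (√(2 * Real.pi))⁻¹ * Real.exp (-(x ^ 2 / 2)) :=
    funext stdPDF_eq
  rw [this]
  fun_prop

lemma integrable_stdPDF_comp_add (s : ℝ) : Integrable fun u => gaussianPDFReal 0 1 (u + s) :=
  (integrable_gaussianPDFReal 0 1).comp_add_right s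

lemma stdCDF_eq_real (x : ℝ) : (gaussianReal 0 1).real (Iic x) = stdCDF x := by
  rw [measureReal_def, gaussianReal_apply_eq_integral 0 one_ne_zero, ENNReal.toReal_ofReal]
  · rfl
  · exact integral_nonneg fun _ => gaussianPDFReal_nonneg _ _ _

lemma stdTail_eq_real (x : ℝ) : (gaussianReal 0 1).real (Ici x) = stdTail x := by
  rw [measureReal_def, gaussianReal_apply_eq_integral 0 one_ne_zero, ENNReal.toReal_ofReal]
  · rfl
  · exact integral_nonneg fun _ => gaussianPDFReal_nonneg _ _ _

lemma stdCDF_add_stdTail (x : ℝ) : stdCDF x + stdTail x = 1 := by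
  rw [stdCDF, stdTail, integral_Ici_eq_integral_Ioi, ← compl_Iic,
    integral_add_compl measurableSet_Iic (integrable_gaussianPDFReal 0 1),
    integral_gaussianPDFReal_eq_one 0 one_ne_zero]

lemma stdCDF_eq_shift (x : ℝ) : stdCDF x = ∫ u in Iic 0, gaussianPDFReal 0 1 (u + x) := by
  have h := (measurePreserving_add_right (volume : Measure ℝ) x).setIntegral_preimage_emb
    (measurableEmbedding_addRight x) (gaussianPDFReal 0 1) (Iic x)
  rw [stdCDF, ← h]
  simp

lemma stdTail_eq_shift (a s : ℝ) :
    stdTail (a + s) = ∫ u in Ici a, gaussianPDFReal 0 1 (u + s) := by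
  have h := (measurePreserving_add_right (volume : Measure ℝ) s).setIntegral_preimage_emb
    (measurableEmbedding_addRight s) (gaussianPDFReal 0 1) (Ici (a + s))
  rw [stdTail, ← h]
  simp

lemma hasDerivAt_stdCDF (x : ℝ) : HasDerivAt stdCDF (gaussianPDFReal 0 1 x) x := by
  have hI := integrable_gaussianPDFReal 0 1
  have h : stdCDF = fun y => stdCDF 0 + ∫ u in (0 : ℝ)..y, gaussianPDFReal 0 1 u := by
    funext y
    rw [← intervalIntegral.integral_Iic_sub_Iic hI.integrableOn hI.integrableOn]
    simp [stdCDF]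
  rw [h]
  exact (intervalIntegral.integral_hasDerivAt_right hI.intervalIntegrable
    (continuous_stdPDF.stronglyMeasurableAtFilter _ _) continuous_stdPDF.continuousAt).const_add _

lemma continuous_stdCDF : Continuous stdCDF :=
  continuous_iff_continuousAt.2 fun x => (hasDerivAt_stdCDF x).continuousAt

lemma stdCDF_pos (x : ℝ) : 0 < stdCDF x := by
  rw [stdCDF, setIntegral_pos_iff_support_of_nonneg_ae
    (ae_of_all _ fun _ => gaussianPDFReal_nonneg _ _ _)
    (integrable_gaussianPDFReal 0 1).integrableOn]
  have : Function.support (gaussianPDFReal 0 1) = univ :=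
    Function.support_eq_univ fun x => (gaussianPDFReal_pos 0 1 x one_ne_zero).ne'
  simp [this]

/-- The reversed hazard rate of the standard Gaussian law is nonincreasing. -/
lemma antitone_stdPDF_div_stdCDF : Antitone fun x => gaussianPDFReal 0 1 x / stdCDF x := by
  intro x y hxy
  simp only
  rw [div_le_div_iff₀ (stdCDF_pos y) (stdCDF_pos x), stdCDF_eq_shift x, stdCDF_eq_shift y,
    ← integral_const_mul, ← integral_const_mul]
  refine setIntegral_mono_on ((integrable_stdPDF_comp_add x).const_mul _).integrableOn
    ((integrable_stdPDF_comp_add y).const_mul _).integrableOn measurableSet_Iic fun u hu => ?_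
  have hu : u ≤ 0 := hu
  -- After cancelling squares, the exponents differ only by -ux against -uy, with u ≤ 0 and x ≤ y.
  simp only [stdPDF_eq]
  rw [mul_mul_mul_comm, mul_mul_mul_comm _ (Real.exp (-(x ^ 2 / 2))), ← Real.exp_add,
    ← Real.exp_add]
  refine mul_le_mul_of_nonneg_left (Real.exp_le_exp.2 ?_) (by positivity)
  nlinarith [mul_nonneg (neg_nonneg.2 hu) (sub_nonneg.2 hxy)]

lemma concaveOn_log_stdCDF : ConcaveOn ℝ univ fun x => Real.log (stdCDF x) := by
  have hd (x : ℝ) : HasDerivAt (fun x => Real.log (stdCDF x))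
      (gaussianPDFReal 0 1 x / stdCDF x) x := (hasDerivAt_stdCDF x).log (stdCDF_pos x).ne'
  refine Antitone.concaveOn_univ_of_deriv (fun x => (hd x).differentiableAt) ?_
  rw [show deriv (fun x => Real.log (stdCDF x)) = fun x => gaussianPDFReal 0 1 x / stdCDF x from
    funext fun x => (hd x).deriv]
  exact antitone_stdPDF_div_stdCDF

/-- The density ratio at u + s and u is exp(-(us + s²/2)), largest over u ≥ a at u = a. -/
lemma stdTail_add_le (a : ℝ) {s : ℝ} (hs : 0 ≤ s) :
    stdTail (a + s) ≤ Real.exp (-(a * s + s ^ 2 / 2)) * stdTail a := by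
  rw [stdTail_eq_shift, stdTail, ← integral_const_mul]
  refine setIntegral_mono_on (integrable_stdPDF_comp_add s).integrableOn
    ((integrable_gaussianPDFReal 0 1).const_mul _).integrableOn measurableSet_Ici fun u hu => ?_
  have hu : a ≤ u := hu
  simp only [stdPDF_eq]
  rw [mul_left_comm, ← Real.exp_add]
  gcongr
  nlinarith [mul_nonneg hs (sub_nonneg.2 hu)]

/-- Only [y, y + 1] is kept; there the density is bounded below using √(2π) ≤ e and (y + 1)²/2 ≤ y²
+ 1. -/
lemma exp_neg_sq_le_stdTail {y : ℝ} (hy : 0 ≤ y) : Real.exp (-(y ^ 2 + 2)) ≤ stdTail y := by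
  have hI := integrable_gaussianPDFReal 0 1
  have h1 : ∫ _ in Icc y (y + 1), Real.exp (-(y ^ 2 + 2)) ≤
      ∫ u in Icc y (y + 1), gaussianPDFReal 0 1 u := by
    refine setIntegral_mono_on (integrable_const _) hI.integrableOn measurableSet_Icc
      fun u hu => ?_
    rw [stdPDF_eq]
    have hpi : √(2 * Real.pi) ≤ Real.exp 1 := by
      rw [Real.sqrt_le_left (Real.exp_pos _).le]
      nlinarith [Real.exp_one_gt_d9, Real.pi_lt_d2]
    calc Real.exp (-(y ^ 2 + 2)) = (Real.exp 1)⁻¹ * Real.exp (-(y ^ 2 + 1)) := by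
          rw [← Real.exp_neg, ← Real.exp_add]; ring_nf
      _ ≤ _ := by
          gcongr
          nlinarith [pow_le_pow_left₀ (hy.trans hu.1) hu.2 2, sq_nonneg (y - 1)]
  have h2 : ∫ u in Icc y (y + 1), gaussianPDFReal 0 1 u ≤ stdTail y :=
    setIntegral_mono_set hI.integrableOn (ae_of_all _ fun _ => gaussianPDFReal_nonneg _ _ _)
      (Filter.Eventually.of_forall Icc_subset_Ici_self)
  have h3 : ∫ _ in Icc y (y + 1), Real.exp (-(y ^ 2 + 2)) = Real.exp (-(y ^ 2 + 2)) := by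
    simp
  linarith

/-! ### Jensen's inequality at the mean -/

/-- If a continuous function `F` is the distribution function of `ν`, then `F` is stochastically
at least uniform under `ν`. -/
lemma measure_cdf_le_le {ν : Measure ℝ} [IsProbabilityMeasure ν] {F : ℝ → ℝ}
    (hF : Continuous F) (hν : ∀ x, ν.real (Iic x) = F x) (u : ℝ) :
    ν {x | F x ≤ u} ≤ ENNReal.ofReal u := by
  rcases le_or_gt 1 u with hu | hu
  · exact prob_le_one.trans (by simpa using ENNReal.ofReal_le_ofReal hu)
  rcases eq_empty_or_nonempty {x | F x ≤ u} with h0 | hne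
  · simp [h0]
  have hlim : Filter.Tendsto F Filter.atTop (nhds 1) := by
    have h : F = cdf ν := funext fun x => by rw [cdf_eq_real, hν]
    rw [h]
    exact tendsto_cdf_atTop ν
  have hmono : Monotone F := fun x y hxy => by
    rw [← hν, ← hν]
    exact measureReal_mono (Iic_subset_Iic.2 hxy)
  -- As u < 1, the sublevel set is bounded above; being closed, it contains its supremum.
  obtain ⟨B, hB⟩ := (hlim.eventually (lt_mem_nhds hu)).exists
  have hbdd : BddAbove {x | F x ≤ u} :=
    ⟨B, fun x hx => le_of_not_gt fun h => (hB.trans_le (hmono h.le)).not_ge hx⟩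
  have hmem : F (sSup {x | F x ≤ u}) ≤ u :=
    (isClosed_le hF continuous_const).csSup_mem hne hbdd
  calc ν {x | F x ≤ u} ≤ ν (Iic (sSup {x | F x ≤ u})) :=
        measure_mono fun x hx => le_csSup hbdd hx
    _ = ENNReal.ofReal (F (sSup {x | F x ≤ u})) := by rw [← hν, ofReal_measureReal]
    _ ≤ ENNReal.ofReal u := ENNReal.ofReal_le_ofReal hmem

/-- By the layer-cake formula: -log F is dominated by an exponential variable of mean 1. -/
lemma lintegral_neg_log_cdf_le_one {ν : Measure ℝ} [IsProbabilityMeasure ν] {F : ℝ → ℝ}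
    (hF : Continuous F) (hpos : ∀ x, 0 < F x) (hν : ∀ x, ν.real (Iic x) = F x) :
    ∫⁻ x, ENNReal.ofReal (-Real.log (F x)) ∂ν ≤ 1 := by
  have hle (x : ℝ) : F x ≤ 1 := hν x ▸ measureReal_le_one
  rw [lintegral_eq_lintegral_meas_le ν
    (ae_of_all _ fun x => neg_nonneg.2 (Real.log_nonpos (hpos x).le (hle x)))
    (Real.measurable_log.comp hF.measurable).neg.aemeasurable]
  calc ∫⁻ t in Ioi 0, ν {x | t ≤ -Real.log (F x)}
      ≤ ∫⁻ t in Ioi 0, ENNReal.ofReal (Real.exp (-t)) := by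
        refine lintegral_mono fun t => ?_
        refine le_trans (measure_mono fun x hx => ?_) (measure_cdf_le_le hF hν (Real.exp (-t)))
        have hx : t ≤ -Real.log (F x) := hx
        exact (Real.log_le_iff_le_exp (hpos x)).1 (by linarith)
    _ = 1 := by
        rw [← ofReal_integral_eq_lintegral_ofReal (integrableOn_exp_neg_Ioi 0)
          (ae_of_all _ fun _ => (Real.exp_pos _).le), integral_exp_neg_Ioi_zero,
          ENNReal.ofReal_one]

/-- Jensen's inequality for a log-concave distribution function. -/
lemma exp_neg_one_le_cdf_integral {ν : Measure ℝ} [IsProbabilityMeasure ν] {F : ℝ → ℝ}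
    (hF : Continuous F) (hpos : ∀ x, 0 < F x) (hν : ∀ x, ν.real (Iic x) = F x)
    (hconc : ConcaveOn ℝ univ fun x => Real.log (F x)) (hint : Integrable (fun x => x) ν) :
    -1 ≤ Real.log (F (∫ x, x ∂ν)) := by
  have hle (x : ℝ) : F x ≤ 1 := hν x ▸ measureReal_le_one
  have hc : Continuous fun x => Real.log (F x) := hF.log fun x => (hpos x).ne'
  have hnn : 0 ≤ᵐ[ν] fun x => -Real.log (F x) :=
    ae_of_all _ fun x => neg_nonneg.2 (Real.log_nonpos (hpos x).le (hle x))
  have hl := lintegral_neg_log_cdf_le_one hF hpos hν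
  have hi : Integrable (fun x => -Real.log (F x)) ν :=
    (lintegral_ofReal_ne_top_iff_integrable hc.neg.aestronglyMeasurable hnn).1
      (hl.trans_lt ENNReal.one_lt_top).ne
  have h1 : ∫ x, -Real.log (F x) ∂ν ≤ 1 := by
    rw [integral_eq_lintegral_of_nonneg_ae hnn hc.neg.aestronglyMeasurable]
    exact ENNReal.toReal_le_of_le_ofReal zero_le_one (by simpa using hl)
  have h2 := hconc.le_map_integral hc.continuousOn isClosed_univ (ae_of_all _ fun _ => mem_univ _)
    hint (by simpa [Function.comp_def] using hi.neg)
  rw [integral_neg] at h1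
  linarith

/-! ### The maximum of the coordinates -/

instance (n : ℕ) : IsProbabilityMeasure (gamma n) := by
  unfold gamma; infer_instance

lemma measurable_maxCoord (n : ℕ) : Measurable (maxCoord n) :=
  Measurable.iSup fun i => measurable_pi_apply i

lemma maxCoord_le_iff {n : ℕ} (hn : 1 ≤ n) (x : Fin n → ℝ) (s : ℝ) :
    maxCoord n x ≤ s ↔ ∀ i, x i ≤ s := by
  have : Nonempty (Fin n) := ⟨⟨0, hn⟩⟩
  exact ciSup_le_iff (finite_range x).bddAbove

lemma le_maxCoord {n : ℕ} (x : Fin n → ℝ) (i : Fin n) : x i ≤ maxCoord n x :=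
  le_ciSup (finite_range x).bddAbove i

lemma exists_eq_maxCoord {n : ℕ} (hn : 1 ≤ n) (x : Fin n → ℝ) : ∃ i, x i = maxCoord n x := by
  have : Nonempty (Fin n) := ⟨⟨0, hn⟩⟩
  exact exists_eq_ciSup_of_finite

lemma integrable_coord {n : ℕ} (i : Fin n) : Integrable (fun x : Fin n → ℝ => x i) (gamma n) :=
  (measurePreserving_eval (fun _ : Fin n => gaussianReal 0 1) i).integrable_comp_of_integrable
    (g := fun x : ℝ => x) (memLp_one_iff_integrable.1 (memLp_id_gaussianReal 1))

lemma integral_coord {n : ℕ} (i : Fin n) : ∫ x, x i ∂gamma n = 0 := by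
  have h := (measurePreserving_eval (fun _ : Fin n => gaussianReal 0 1) i)
  have h2 := integral_map (μ := gamma n) h.measurable.aemeasurable (f := fun x : ℝ => x)
    (by fun_prop)
  rw [gamma, h.map_eq, integral_id_gaussianReal] at h2
  exact h2.symm

lemma integrable_maxCoord {n : ℕ} (hn : 1 ≤ n) : Integrable (maxCoord n) (gamma n) := by
  refine (integrable_finsetSum Finset.univ fun i _ => (integrable_coord i).abs).mono'
    (measurable_maxCoord n).aestronglyMeasurable (ae_of_all _ fun x => ?_)
  obtain ⟨i, hi⟩ := exists_eq_maxCoord hn x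
  rw [← hi, Real.norm_eq_abs]
  exact Finset.single_le_sum (f := fun i => |x i|) (fun _ _ => abs_nonneg _) (Finset.mem_univ i)

lemma integral_maxCoord_nonneg {n : ℕ} (hn : 1 ≤ n) : 0 ≤ ∫ x, maxCoord n x ∂gamma n := by
  rw [← integral_coord (⟨0, hn⟩ : Fin n)]
  exact integral_mono (integrable_coord _) (integrable_maxCoord hn) fun x => le_maxCoord x _

lemma map_maxCoord_real_Iic {n : ℕ} (hn : 1 ≤ n) (s : ℝ) :
    ((gamma n).map (maxCoord n)).real (Iic s) = stdCDF s ^ n := by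
  rw [map_measureReal_apply (measurable_maxCoord n) measurableSet_Iic]
  have h : maxCoord n ⁻¹' Iic s = univ.pi fun _ => Iic s := by
    ext x
    simp only [mem_preimage, mem_Iic, maxCoord_le_iff hn, mem_univ_pi]
  rw [h, gamma, measureReal_def, Measure.pi_pi, ENNReal.toReal_prod]
  simp [← measureReal_def, stdCDF_eq_real]

lemma real_le_maxCoord_le {n : ℕ} (hn : 1 ≤ n) (s : ℝ) :
    (gamma n).real {x | s ≤ maxCoord n x} ≤ n * stdTail s := by
  have hsub : {x | s ≤ maxCoord n x} ⊆ ⋃ i : Fin n, Function.eval i ⁻¹' Ici s := fun x hx => by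
    obtain ⟨i, hi⟩ := exists_eq_maxCoord hn x
    exact mem_iUnion.2 ⟨i, le_of_le_of_eq hx hi.symm⟩
  refine (measureReal_mono hsub).trans ((measureReal_iUnion_fintype_le _).trans_eq ?_)
  have h (i : Fin n) : (gamma n).real (Function.eval i ⁻¹' Ici s) = stdTail s := by
    rw [← stdTail_eq_real, ← (measurePreserving_eval (fun _ : Fin n => gaussianReal 0 1) i).map_eq,
      map_measureReal_apply (measurable_pi_apply i) measurableSet_Ici]
    rfl
  simp [h]

/-- A single coordinate exceeds the mean of the maximum with probability at most `1 / n`. -/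
lemma mul_stdTail_integral_maxCoord_le_one {n : ℕ} (hn : 1 ≤ n) :
    n * stdTail (∫ x, maxCoord n x ∂gamma n) ≤ 1 := by
  have hm := measurable_maxCoord n
  have := Measure.isProbabilityMeasure_map (μ := gamma n) hm.aemeasurable
  have key := exp_neg_one_le_cdf_integral (ν := (gamma n).map (maxCoord n))
    (F := fun x => stdCDF x ^ n) (continuous_stdCDF.pow n) (fun x => pow_pos (stdCDF_pos x) n)
    (map_maxCoord_real_Iic hn)
    (by
      simp only [Real.log_pow]
      exact concaveOn_log_stdCDF.smul (Nat.cast_nonneg n))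
    ((integrable_map_measure (by fun_prop) hm.aemeasurable).2 (integrable_maxCoord hn))
  rw [integral_map hm.aemeasurable (by fun_prop), Real.log_pow] at key
  set m := ∫ x, maxCoord n x ∂gamma n
  have h1 := Real.log_le_sub_one_of_pos (stdCDF_pos m)
  have h2 : stdTail m ≤ -Real.log (stdCDF m) := by linarith [stdCDF_add_stdTail m]
  nlinarith [mul_le_mul_of_nonneg_left h2 (Nat.cast_nonneg (α := ℝ) n)]

lemma log_le_integral_maxCoord_sq_add_two {n : ℕ} (hn : 1 ≤ n) :
    Real.log n ≤ (∫ x, maxCoord n x ∂gamma n) ^ 2 + 2 := by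
  have h := mul_stdTail_integral_maxCoord_le_one hn
  have h0 := exp_neg_sq_le_stdTail (integral_maxCoord_nonneg hn)
  set m := ∫ x, maxCoord n x ∂gamma n
  have hn' : (0 : ℝ) < n := by exact_mod_cast hn
  rw [Real.log_le_iff_le_exp hn']
  have h3 := (mul_le_mul_of_nonneg_left h0 hn'.le).trans h
  rwa [Real.exp_neg, ← div_eq_mul_inv, div_le_one (Real.exp_pos _)] at h3

lemma real_sub_integral_maxCoord_ge_le {n : ℕ} (hn : 1 ≤ n) {t : ℝ} (ht : 0 ≤ t) :
    (gamma n).real {x | t ≤ maxCoord n x - ∫ y, maxCoord n y ∂gamma n} ≤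
      Real.exp (-((∫ y, maxCoord n y ∂gamma n) * t + t ^ 2 / 2)) := by
  have h := mul_stdTail_integral_maxCoord_le_one hn
  set m := ∫ x, maxCoord n x ∂gamma n
  have hset : {x | t ≤ maxCoord n x - m} = {x | m + t ≤ maxCoord n x} := by
    ext x
    simp [le_sub_iff_add_le']
  rw [hset]
  calc _ ≤ n * stdTail (m + t) := real_le_maxCoord_le hn _
    _ ≤ n * (Real.exp (-(m * t + t ^ 2 / 2)) * stdTail m) := by
        gcongr
        exact stdTail_add_le m ht
    _ = Real.exp (-(m * t + t ^ 2 / 2)) * (n * stdTail m) := by ring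
    _ ≤ _ := mul_le_of_le_one_right (Real.exp_pos _).le h

end GaussianMax

theorem mainTheorem4 :
    ∃ c : ℝ, 0 < c ∧ ∀ n : ℕ, 1 ≤ n →
      Integrable (GaussianMax.maxCoord n) (GaussianMax.gamma n) ∧
      ∀ t : ℝ, 0 ≤ t →
        (GaussianMax.gamma n).real
            {x | t ≤ GaussianMax.maxCoord n x - ∫ y, GaussianMax.maxCoord n y ∂(GaussianMax.gamma n)}
          ≤ 3 * Real.exp (-(c * t * Real.sqrt (Real.log n))) := by
  refine ⟨1 / 2, by norm_num, fun n hn => ⟨GaussianMax.integrable_maxCoord hn, fun t ht => ?_⟩⟩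
  refine (GaussianMax.real_sub_integral_maxCoord_ge_le hn ht).trans ?_
  have hm := GaussianMax.integral_maxCoord_nonneg hn
  have hlog := GaussianMax.log_le_integral_maxCoord_sq_add_two hn
  set m := ∫ x, GaussianMax.maxCoord n x ∂GaussianMax.gamma n
  have hsqrt : √(Real.log n) ≤ m + 2 := by
    rw [Real.sqrt_le_left (by linarith)]
    nlinarith
  have h3 : Real.exp 1 ≤ 3 := by linarith [Real.exp_one_lt_d9]
  calc Real.exp (-(m * t + t ^ 2 / 2))
      ≤ Real.exp (1 + -(1 / 2 * t * √(Real.log n))) := by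
        gcongr
        -- Half of t(m + 2) is mt/2 + t, and t ≤ 1 + t²/2; the extra 1 costs the factor e ≤ 3.
        nlinarith [mul_le_mul_of_nonneg_left hsqrt ht, mul_nonneg hm ht, sq_nonneg (t - 1)]
    _ = Real.exp 1 * Real.exp (-(1 / 2 * t * √(Real.log n))) := Real.exp_add _ _
    _ ≤ _ := by gcongr
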